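/- A \emph{dynamic metric space (DMS)} $\gamma_X=(X,d_X(\cdot))$ is a non-empty finite set $X$ with a map $d_X:\mathbb R\times X\times X\to[0,\infty)$ such that $d_X(t)$ is a pseudo-metric for every $t\in\mathbb R$, $d_X(t_0)$ is a metric for some $t_0$, and $t\mapsto d_X(t)(x,x')$ is continuous for all $x,x'\in X$. It is \emph{tame} if for all $x,x'\in X$, every level set of $t\mapsto d_X(t)(x,x')$ meets every bounded interval in a set with finitely many connected components. Two DMSs are \emph{isomorphic} if there is a bijection of the underlying sets that is an isometry at every time. A tripod $X\xleftarrow{\varphi_X} Z\xrightarrow{\varphi_Y}Y$ is a pair of surjections; $d_{\mathrm I}^{\mathrm{dynM}}(\gamma_X,\gamma_Y)\in[0,\infty]$ is the infimum of the $\varepsilon\ge 0$ for which there is a tripod such that for all $t\in\mathbb R$ and $z,z'\in Z$, with $x=\varphi_X(z)$, $x'=\varphi_X(z')$, $y=\varphi_Y(z)$, $y'=\varphi_Y(z')$, $$\min_{|s-t|\le\varepsilon}d_X(s)(x,x')\le d_Y(t)(y,y')\quad\text{and}\quad \min_{|s-t|\le\varepsilon}d_Y(s)(y,y')\le d_X(t)(x,x').$$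 For $\delta\ge 0$, $\mathcal R_\delta(\gamma_X)(t)$ is the Rips complex of $(X,d_X(t))$: its simplices are the non-empty $\sigma\subseteq X$ of $d_X(t)$-diameter at most $\delta$. This is a zigzag simplicial filtration when $\gamma_X$ is tame. Its $k$-th homology barcode (simplicial homology over a field $\mathbb F$) is obtained by choosing $\cdots<c_i<s_i<c_{i+1}<\cdots$ with $c_i\to\pm\infty$ as $i\to\pm\infty$ such that the $c_i$ include all times of discontinuity of the filtration, decomposing the zigzag module with maps $\mathrm H_k(\mathcal R_\delta(\gamma_X)(s_i))\to \mathrm H_k(\mathcal R_\delta(\gamma_X)(c_i))$ and $\mathrm H_k(\mathcal R_\delta(\gamma_X)(s_i))\to \mathrm H_k(\mathcal R_\delta(\gamma_X)(c_{i+1}))$ into interval modules, and recording for each summand the interval of $\mathbb R$ obtained as the union of the points $\{c_i\}$ and the open intervals $(c_i,c_{i+1})$ for those indices $c_i$, $s_i$ at which the summand is non-zero. The bottleneck distance $d_{\mathrm B}$ between two multisets of intervals is the infimum of the $\varepsilon\ge0$ for which there is a partial matching that leaves no interval containing some $[t,t+2\varepsilon]$ unmatched and in which each of two matched intervals is contained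 in the $\varepsilon$-thickening of the other (and $+\infty$ if there is no such $\varepsilon$). \textbf{Theorem.} For every integer $k\ge 1$ there are two non-isomorphic tame DMSs $\gamma_{X_k}$, $\gamma_{Y_k}$ and $\delta_k\ge 0$ such that $d_{\mathrm I}^{\mathrm{dynM}}(\gamma_{X_k},\gamma_{Y_k})\le \pi/2<\infty$, but for every field $\mathbb F$ the $k$-th homology barcodes over $\mathbb F$ of $\mathcal R_{\delta_k}(\gamma_{X_k})$ and of $\mathcal R_{\delta_k}(\gamma_{Y_k})$ exist and are at bottleneck distance $+\infty$. One may take for $\gamma_{X_k}$ the constant DMS of the $2(k+1)$ points $\pm e_1,\dots,\pm e_{k+1}$ in Euclidean $\mathbb R^{k+1}$, for $\gamma_{Y_k}$ the DMS obtained from it by replacing the point $+e_1$ by the oscillating point $(1+\sin^2 t)\,e_1$ ($t\in\mathbb R$), and $\delta_k=\sqrt2$. -/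

import Mathlib

open scoped CategoryTheory NNReal ENNReal DirectSum

/-! ## Dynamic metric spaces -/

/-- A dynamic metric space: a non-empty finite set with a time-dependent pseudo-metric that is
continuous in time and is a metric at some time. -/
structure DMS where
  X : Type
  [fintype : Fintype X]
  [nonempty : Nonempty X]
  dist : ℝ → X → X → ℝ
  dist_nonneg : ∀ t x y, 0 ≤ dist t x y
  dist_self : ∀ t x, dist t x x = 0
  dist_comm : ∀ t x y, dist t x y = dist t y x
  dist_triangle : ∀ t x y z, dist t x z ≤ dist t x y + dist t y z
  exists_metric : ∃ t₀, ∀ x y, dist t₀ x y = 0 → x = y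
  continuous_dist : ∀ x y, Continuous fun t => dist t x y

attribute [instance] DMS.fintype DMS.nonempty

/-- A continuous function `f : ℝ → ℝ` is tame if every level set meets every bounded interval in
a set with finitely many connected components (possibly none). -/
def TameFunction (f : ℝ → ℝ) : Prop :=
  Continuous f ∧ ∀ (c : ℝ) (I : Set ℝ), I.OrdConnected → Bornology.IsBounded I →
    Finite (ConnectedComponents ↥(f ⁻¹' {c} ∩ I))

namespace DMS

/-- A DMS is tame if all its distance functions are tame. -/
def Tame (γ : DMS) : Prop := ∀ x y : γ.X, TameFunction fun t => γ.dist t x y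

/-- Isomorphic DMSs: a bijection which is an isometry at all times. -/
def Isomorphic (γ₁ γ₂ : DMS) : Prop :=
  ∃ φ : γ₁.X ≃ γ₂.X, ∀ t x y, γ₂.dist t (φ x) (φ y) = γ₁.dist t x y

/-- `(⋁_I d_X)(x, y)`, the minimum over `t ∈ I` of `d_X(t)(x, y)`. (By continuity the infimum is
attained when `I` is a non-empty compact interval, the only case in which it is used.) -/
noncomputable def minDist (γ : DMS) (I : Set ℝ) (x y : γ.X) : ℝ :=
  sInf ((fun t => γ.dist t x y) '' I)

/-- The DMS of finitely many points moving continuously in a normed space, distinct at some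
time. -/
noncomputable def ofTrajectories {V E : Type} [Fintype V] [Nonempty V] [NormedAddCommGroup E]
    (p : V → ℝ → E) (hp : ∀ v, Continuous (p v))
    (h : ∃ t₀, Function.Injective fun v => p v t₀) : DMS where
  X := V
  dist t x y := ‖p x t - p y t‖
  dist_nonneg _ _ _ := norm_nonneg _
  dist_self _ _ := by simp
  dist_comm _ _ _ := norm_sub_rev _ _
  dist_triangle _ _ _ _ := norm_sub_le_norm_sub_add_norm_sub _ _ _
  exists_metric := by
    obtain ⟨t₀, ht⟩ := h
    exact ⟨t₀, fun x y hxy => ht (sub_eq_zero.mp (norm_eq_zero.mp hxy))⟩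
  continuous_dist x y := ((hp x).sub (hp y)).norm

end DMS

/-! ## The interleaving distance between dynamic metric spaces -/

/-- A tripod between `X` and `Y`: a pair of surjections from a set `Z`. -/
structure Tripod (X Y : Type) where
  Z : Type
  left : Z → X
  right : Z → Y
  left_surjective : Function.Surjective left
  right_surjective : Function.Surjective right

/-- `R` is a `(lam, ε)`-tripod between two DMSs. -/
def IsSlackTripod (lam ε : ℝ≥0) (γ₁ γ₂ : DMS) (R : Tripod γ₁.X γ₂.X) : Prop :=
  ∀ (t : ℝ) (z z' : R.Z),
    γ₁.minDist (Set.Icc (t - ε) (t + ε)) (R.left z) (R.left z')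
      ≤ γ₂.dist t (R.right z) (R.right z') + lam * ε ∧
    γ₂.minDist (Set.Icc (t - ε) (t + ε)) (R.right z) (R.right z')
      ≤ γ₁.dist t (R.left z) (R.left z') + lam * ε

/-- The `lam`-distortion of a tripod (`⊤` if it is not a `(lam, ε)`-tripod for any `ε`). -/
noncomputable def slackDistortion (lam : ℝ≥0) (γ₁ γ₂ : DMS) (R : Tripod γ₁.X γ₂.X) : ℝ≥0∞ :=
  ⨅ (ε : ℝ≥0) (_ : IsSlackTripod lam ε γ₁ γ₂ R), (ε : ℝ≥0∞)

/-- The `lam`-slack interleaving distance. -/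
noncomputable def slackInterleavingDist (lam : ℝ≥0) (γ₁ γ₂ : DMS) : ℝ≥0∞ :=
  ⨅ R : Tripod γ₁.X γ₂.X, slackDistortion lam γ₁ γ₂ R

/-- The interleaving distance between DMSs: no slack. -/
noncomputable def dynMDist (γ₁ γ₂ : DMS) : ℝ≥0∞ := slackInterleavingDist 0 γ₁ γ₂

/-! ## Simplicial homology -/

section Homology

variable (F : Type*) [Field F] {X : Type*}

/-- Oriented simplicial `k`-chains of `K` with coefficients in `F`: alternating functions on
`(k+1)`-tuples of vertices that vanish on every tuple not listing the vertices of a `k`-simplex of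
`K` without repetition. The elementary chain of the oriented simplex `[x₀, …, x_k]` takes the value
`sign π` at `(x_{π 0}, …, x_{π k})` and `0` elsewhere. -/
def simplicialChains (K : PreAbstractSimplicialComplex X) (k : ℕ) :
    Submodule F ((Fin (k + 1) → X) → F) where
  carrier := {c | (∀ (π : Equiv.Perm (Fin (k + 1))) (x : Fin (k + 1) → X),
      c (x ∘ π) = ((Equiv.Perm.sign π : ℤ) : F) * c x) ∧
    ∀ x, c x ≠ 0 → Function.Injective x ∧ ∃ s ∈ K, (s : Set X) = Set.range x}
  add_mem' := by
    rintro a b ⟨ha, ha'⟩ ⟨hb, hb'⟩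
    refine ⟨fun π x => by simp [ha, hb, mul_add], fun x hx => ?_⟩
    by_cases h : a x = 0
    · exact hb' x fun h' => hx (by simp [h, h'])
    · exact ha' x h
  zero_mem' := ⟨fun π x => by simp, fun x hx => absurd rfl hx⟩
  smul_mem' := by
    rintro r a ⟨ha, ha'⟩
    refine ⟨fun π x => by simp [ha, mul_left_comm], fun x hx => ha' x fun h => hx (by simp [h])⟩

variable (X) in
/-- The boundary operator. On the elementary chain of `[x₀, …, x_k]` it gives
`∑ i, (-1)^i [x₀, …, x̂_i, …, x_k]`: the coefficient of `∂ c` at an oriented `(k-1)`-simplex `x` is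
the sum of the coefficients of `c` at the oriented `k`-simplices `[v, x]`. -/
def simplicialBoundary [Fintype X] (n : ℕ) :
    ((Fin (n + 1) → X) → F) →ₗ[F] ((Fin n → X) → F) where
  toFun c x := ∑ v, c (Fin.cons v x)
  map_add' a b := by ext x; simp [Finset.sum_add_distrib]
  map_smul' r a := by ext x; simp [Finset.mul_sum]

/-- The `k`-cycles; every `0`-chain is a cycle (unreduced homology). -/
def simplicialCycles [Fintype X] (K : PreAbstractSimplicialComplex X) :
    (k : ℕ) → Submodule F ((Fin (k + 1) → X) → F)
  | 0 => simplicialChains F K 0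
  | k + 1 => simplicialChains F K (k + 1) ⊓ LinearMap.ker (simplicialBoundary F X (k + 1))

/-- The `k`-boundaries. -/
def simplicialBoundaries [Fintype X] (K : PreAbstractSimplicialComplex X) (k : ℕ) :
    Submodule F ((Fin (k + 1) → X) → F) :=
  (simplicialChains F K (k + 1)).map (simplicialBoundary F X (k + 1))

/-- The `k`-th simplicial homology of `K` with coefficients in `F`. -/
abbrev SimplicialHomology [Fintype X] (K : PreAbstractSimplicialComplex X) (k : ℕ) :=
  ↥(simplicialCycles F K k) ⧸
    (simplicialBoundaries F K k).submoduleOf (simplicialCycles F K k)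

variable {K L M : PreAbstractSimplicialComplex X}

theorem simplicialChains_mono (h : K ≤ L) (k : ℕ) :
    simplicialChains F K k ≤ simplicialChains F L k := by
  rintro c ⟨h₁, h₂⟩
  refine ⟨h₁, fun x hx => ?_⟩
  obtain ⟨hi, s, hs, hr⟩ := h₂ x hx
  exact ⟨hi, s, h hs, hr⟩

theorem simplicialCycles_mono [Fintype X] (h : K ≤ L) :
    ∀ k, simplicialCycles F K k ≤ simplicialCycles F L k
  | 0 => simplicialChains_mono F h 0
  | k + 1 => inf_le_inf_right _ (simplicialChains_mono F h (k + 1))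

/-- The map on homology induced by an inclusion of complexes on the same vertex set. -/
def simplicialHomologyMap [Fintype X] (h : K ≤ L) (k : ℕ) :
    SimplicialHomology F K k →ₗ[F] SimplicialHomology F L k :=
  Submodule.mapQ _ _ (Submodule.inclusion (simplicialCycles_mono F h k)) (by
    rintro c hc
    exact Submodule.map_mono (simplicialChains_mono F h (k + 1)) hc)

theorem simplicialHomologyMap_id [Fintype X] (h : K ≤ K) (k : ℕ) :
    simplicialHomologyMap F h k = LinearMap.id := by
  ext c
  rfl

theorem simplicialHomologyMap_comp [Fintype X] (h : K ≤ L) (h' : L ≤ M) (k : ℕ) :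
    simplicialHomologyMap F (h.trans h') k =
      simplicialHomologyMap F h' k ∘ₗ simplicialHomologyMap F h k := by
  ext c
  rfl

end Homology

/-! ## Modules over a poset and their interval decompositions -/

section PosetModules

/-- An interval of a poset: non-empty, convex and connected through comparable elements. -/
structure PosetInterval (P : Type) [PartialOrder P] where
  carrier : Set P
  nonempty : carrier.Nonempty
  convex : ∀ r s t, r ∈ carrier → t ∈ carrier → r ≤ s → s ≤ t → s ∈ carrier
  connected : ∀ s ∈ carrier, ∀ t ∈ carrier,
    Relation.ReflTransGen (fun a b => a ∈ carrier ∧ b ∈ carrier ∧ (a ≤ b ∨ b ≤ a)) s t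

variable (F : Type*) [Field F] {P : Type} [PartialOrder P]

/-- The value at `t` of the interval module of `J`, as a subspace of `F`: it is `F` if `t ∈ J`, and
`0` otherwise. -/
def intervalSpace (J : PosetInterval P) (t : P) : Submodule F F where
  carrier := {a | t ∉ J.carrier → a = 0}
  add_mem' ha hb h := by simp [ha h, hb h]
  zero_mem' _ := rfl
  smul_mem' r a ha h := by simp [ha h]

open Classical in
/-- The map of the interval module of `J` from `s` to `t` (for `s ≤ t`): the identity of `F` if
`s, t ∈ J`, and `0` otherwise. -/
noncomputable def intervalMap (J : PosetInterval P) (s t : P) :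
    intervalSpace F J s →ₗ[F] intervalSpace F J t where
  toFun a := ⟨if s ∈ J.carrier ∧ t ∈ J.carrier then a.1 else 0, fun h => by simp [h]⟩
  map_add' a b := by ext; dsimp; split_ifs <;> simp
  map_smul' r a := by ext; dsimp; split_ifs <;> simp

theorem intervalMap_id (J : PosetInterval P) (t : P) :
    intervalMap F J t t = LinearMap.id := by
  ext ⟨a, ha⟩
  by_cases h : t ∈ J.carrier
  · simp [intervalMap, h]
  · simp [intervalMap, h, ha h]

theorem intervalMap_comp (J : PosetInterval P) {r s t : P} (h : r ≤ s) (h' : s ≤ t) :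
    intervalMap F J r t = intervalMap F J s t ∘ₗ intervalMap F J r s := by
  ext ⟨a, ha⟩
  by_cases hr : r ∈ J.carrier <;> by_cases ht : t ∈ J.carrier
  · simp [intervalMap, hr, ht, J.convex r s t hr ht h h']
  all_goals simp [intervalMap, hr, ht]

/-- The direct sum of the interval modules of a family of intervals of `P`, as a `P`-indexed
module. -/
noncomputable def intervalSum {ι : Type} (J : ι → PosetInterval P) : P ⥤ ModuleCat F where
  obj t := ModuleCat.of F (⨁ j, intervalSpace F (J j) t)
  map {s t} _ := ModuleCat.ofHom (DirectSum.lmap fun j => intervalMap F (J j) s t)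
  map_id t := by
    ext1
    simp only [intervalMap_id]
    exact DirectSum.lmap_id
  map_comp {r s t} h h' := by
    ext1
    simp only [fun j => intervalMap_comp F (J j) (CategoryTheory.leOfHom h) (CategoryTheory.leOfHom h')]
    exact DirectSum.lmap_comp _ _

variable {X : Type} [Fintype X]

/-- The `P`-indexed module obtained by applying `k`-th homology to a monotone family of complexes
on `X` indexed by `P`. -/
def homologyModule (k : ℕ) (S : P →o PreAbstractSimplicialComplex X) : P ⥤ ModuleCat F where
  obj p := ModuleCat.of F (SimplicialHomology F (S p) k)
  map h := ModuleCat.ofHom (simplicialHomologyMap F (S.monotone (CategoryTheory.leOfHom h)) k)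
  map_id p := by
    ext1
    exact simplicialHomologyMap_id F (le_refl (S p)) k
  map_comp h h' := by
    ext1
    exact simplicialHomologyMap_comp F (S.monotone (CategoryTheory.leOfHom h))
      (S.monotone (CategoryTheory.leOfHom h')) k

end PosetModules

/-- The zigzag poset `{(k, l) : k ∈ ℤ, l ∈ {k, k - 1}} ⊆ ℤᵒᵖ × ℤ`: `c i` stands for `(i, i)` and
`s i` for `(i + 1, i)`, so the strict relations are `s i < c i` and `s i < c (i + 1)`. -/
inductive ZZ
  | c (i : ℤ)
  | s (i : ℤ)

namespace ZZ

def toPair : ZZ → ℤᵒᵈ × ℤ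
  | c i => (OrderDual.toDual i, i)
  | s i => (OrderDual.toDual (i + 1), i)

theorem toPair_injective : Function.Injective toPair := by
  rintro (i | i) (j | j) h <;> simp only [toPair, Prod.mk.injEq, OrderDual.toDual_inj] at h
  · rw [h.1]
  · omega
  · omega
  · rw [h.2]

noncomputable instance : PartialOrder ZZ := PartialOrder.lift toPair toPair_injective

theorem le_cases {p q : ZZ} (h : p ≤ q) :
    p = q ∨ ∃ i, p = s i ∧ (q = c i ∨ q = c (i + 1)) := by
  have h' : toPair p ≤ toPair q := h
  rw [Prod.le_def] at h'
  rcases p with i | i <;> rcases q with j | j <;>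
    simp only [toPair, OrderDual.toDual_le_toDual] at h'
  · left; congr 1; omega
  · omega
  · refine Or.inr ⟨i, rfl, ?_⟩
    rcases (by omega : j = i ∨ j = i + 1) with rfl | rfl <;> simp
  · left; congr 1; omega

end ZZ

/-! ## Zigzag simplicial filtrations and their homology barcodes -/

section Filtrations

variable {X : Type}

/-- The points of discontinuity of a time-dependent complex. -/
def critPoints (f : ℝ → PreAbstractSimplicialComplex X) : Set ℝ :=
  {t | ¬ ∀ᶠ u in nhds t, f u = f t}

/-- A zigzag simplicial filtration on `X`: a time-dependent non-empty simplicial complex with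
vertices in `X` whose set of critical points is locally finite, and which at every time `t` contains
the complexes at all times sufficiently close to `t`. -/
structure IsZigzagFiltration (f : ℝ → PreAbstractSimplicialComplex X) : Prop where
  nonempty : ∀ t, (f t).faces.Nonempty
  tame : ∀ a b : ℝ, (critPoints f ∩ Set.Icc a b).Finite
  comparable : ∀ t : ℝ, ∀ᶠ ε in nhdsWithin (0 : ℝ) (Set.Ioi 0), f (t - ε) ≤ f t ∧ f (t + ε) ≤ f t

/-- An indexing set for `f`:
`⋯ < c i < s i < c (i + 1) < ⋯`, with `c i → ±∞` as `i → ±∞`, and all critical points among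
the `c i`. -/
structure IndexingSet (f : ℝ → PreAbstractSimplicialComplex X) where
  c : ℤ → ℝ
  s : ℤ → ℝ
  strictMono_c : StrictMono c
  tendsto_atTop : Filter.Tendsto c Filter.atTop Filter.atTop
  tendsto_atBot : Filter.Tendsto c Filter.atBot Filter.atBot
  crit_subset : critPoints f ⊆ Set.range c
  s_mem : ∀ i, s i ∈ Set.Ioo (c i) (c (i + 1))

namespace IndexingSet

variable {f : ℝ → PreAbstractSimplicialComplex X} (K : IndexingSet f)

/-- The element of the indexing set that corresponds to an element of `ZZ`. -/
def time : ZZ → ℝ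
  | .c i => K.c i
  | .s i => K.s i

theorem eq_of_mem_Ioo (i : ℤ) {u v : ℝ} (hu : u ∈ Set.Ioo (K.c i) (K.c (i + 1)))
    (hv : v ∈ Set.Ioo (K.c i) (K.c (i + 1))) : f u = f v := by
  let _ : TopologicalSpace (PreAbstractSimplicialComplex X) := ⊥
  have : DiscreteTopology (PreAbstractSimplicialComplex X) := ⟨rfl⟩
  refine isPreconnected_Ioo.constant (f := f) (fun t ht => ContinuousAt.continuousWithinAt ?_) hu hv
  by_cases hc : t ∈ critPoints f
  · obtain ⟨j, rfl⟩ := K.crit_subset hc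
    have h₁ := K.strictMono_c.lt_iff_lt.mp ht.1
    have h₂ := K.strictMono_c.lt_iff_lt.mp ht.2
    omega
  · exact tendsto_nhds_of_eventually_eq (not_not.mp hc)

theorem mid_le (hf : IsZigzagFiltration f) (i : ℤ) :
    f (K.s i) ≤ f (K.c i) ∧ f (K.s i) ≤ f (K.c (i + 1)) := by
  have hi : K.c i < K.c (i + 1) := K.strictMono_c (by omega)
  have hsmall : ∀ᶠ ε in nhdsWithin (0 : ℝ) (Set.Ioi 0), ε < K.c (i + 1) - K.c i ∧ 0 < ε :=
    Filter.Eventually.and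
      (nhdsWithin_le_nhds (Iio_mem_nhds (by linarith))) self_mem_nhdsWithin
  constructor
  · obtain ⟨ε, h, h₁, h₂⟩ := ((hf.comparable (K.c i)).and hsmall).exists
    rw [K.eq_of_mem_Ioo i (K.s_mem i) (v := K.c i + ε) ⟨by linarith, by linarith⟩]
    exact h.2
  · obtain ⟨ε, h, h₁, h₂⟩ := ((hf.comparable (K.c (i + 1))).and hsmall).exists
    rw [K.eq_of_mem_Ioo i (K.s_mem i) (v := K.c (i + 1) - ε) ⟨by linarith, by linarith⟩]
    exact h.1

/-- The zigzag diagram of inclusions `f (c i) ⊇ f (s i) ⊆ f (c (i + 1))`. -/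
def diagram (hf : IsZigzagFiltration f) : ZZ →o PreAbstractSimplicialComplex X where
  toFun p := f (K.time p)
  monotone' := by
    intro p q h
    rcases ZZ.le_cases h with rfl | ⟨i, rfl, rfl | rfl⟩
    · exact le_rfl
    · exact (K.mid_le hf i).1
    · exact (K.mid_le hf i).2

/-- The interval of `ℝ` that corresponds to an interval of the indexing set: the union of the
points `c i` and of the open intervals `(c i, c (i + 1))` whose indices `c i`, `s i` belong to it.
So `[c i, c j] ↦ [c i, c j]`, `[c i, s j] ↦ [c i, c (j + 1))`, `[s i, c j] ↦ (c i, c j]`,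
`[s i, s j] ↦ (c i, c (j + 1))`, and likewise for unbounded intervals. -/
def realInterval (J : PosetInterval ZZ) : Set ℝ :=
  (⋃ (i : ℤ) (_ : ZZ.c i ∈ J.carrier), {K.c i}) ∪
    ⋃ (i : ℤ) (_ : ZZ.s i ∈ J.carrier), Set.Ioo (K.c i) (K.c (i + 1))

end IndexingSet

end Filtrations

/-- A multiset of intervals of `ℝ`, as an indexed family (two families that differ by a bijection
of the index sets are the same multiset; infinitely many intervals are allowed). -/
structure Barcode where
  ι : Type
  I : ι → Set ℝ
  nonempty : ∀ j, (I j).Nonempty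
  ordConnected : ∀ j, (I j).OrdConnected

/-- `B` is the `k`-th homology barcode, with coefficients in `F`, of the zigzag simplicial
filtration `f`: for some indexing set, the zigzag module of the `k`-th homology of `f` is isomorphic
to a direct sum of interval modules, and `B` consists of the corresponding intervals of `ℝ`. -/
def IsHomologyBarcode (F : Type*) [Field F] (k : ℕ) {X : Type} [Fintype X]
    (f : ℝ → PreAbstractSimplicialComplex X) (B : Barcode) : Prop :=
  ∃ (hf : IsZigzagFiltration f) (K : IndexingSet f) (J : B.ι → PosetInterval ZZ),
    Nonempty (homologyModule F k (K.diagram hf) ≅ intervalSum F J) ∧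
      ∀ j, B.I j = K.realInterval (J j)

/-! ## The bottleneck distance -/

namespace Barcode

/-- The `δ`-thickening of a set of reals; it turns `⟨b, d⟩` into `⟨b - δ, d + δ⟩`, an interval with
endpoints of the same kind. -/
def thicken (δ : ℝ) (I : Set ℝ) : Set ℝ := {t | ∃ u ∈ I, |t - u| ≤ δ}

/-- `I` contains a closed interval of length `ε`. -/
def IsLong (ε : ℝ) (I : Set ℝ) : Prop := ∃ t, Set.Icc t (t + ε) ⊆ I

/-- `σ` (an injective partial function) is a `δ`-matching between two barcodes. -/
structure IsDeltaMatching (δ : ℝ) (A B : Barcode) (σ : A.ι ≃. B.ι) : Prop where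
  coim : ∀ a, IsLong (2 * δ) (A.I a) → ∃ b, b ∈ σ a
  im : ∀ b, IsLong (2 * δ) (B.I b) → ∃ a, b ∈ σ a
  close : ∀ a b, b ∈ σ a → A.I a ⊆ thicken δ (B.I b) ∧ B.I b ⊆ thicken δ (A.I a)

/-- The bottleneck distance; it is `⊤` if there is no `δ`-matching for any `δ`. -/
noncomputable def bottleneckDist (A B : Barcode) : ℝ≥0∞ :=
  ⨅ (δ : ℝ≥0) (_ : ∃ σ, IsDeltaMatching δ A B σ), (δ : ℝ≥0∞)

end Barcode

/-! ## Rips complexes and the two dynamic metric spaces -/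

/-- The Rips complex at scale `δ` of the DMS at time `t`: its simplices are the non-empty sets of
diameter at most `δ`. As a function of `t` this is the Rips filtration of the DMS. -/
def DMS.rips (γ : DMS) (δ : ℝ) (t : ℝ) : PreAbstractSimplicialComplex γ.X where
  faces := {σ | σ.Nonempty ∧ ∀ x ∈ σ, ∀ y ∈ σ, γ.dist t x y ≤ δ}
  isRelLowerSet_faces := fun _ hσ =>
    ⟨hσ.1, fun _ hle hne => ⟨hne, fun x hx y hy => hσ.2 x (hle hx) y (hle hy)⟩⟩

section Example

/-- The vertex `± e_i` of the cross-polytope in `ℝ^(k+1)`; `(i, true)` is `+ e_i` and `(i, false)`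
is `- e_i`. -/
noncomputable def crossVertex (k : ℕ) (v : Fin (k + 1) × Bool) :
    EuclideanSpace ℝ (Fin (k + 1)) :=
  EuclideanSpace.single v.1 (if v.2 then 1 else -1)

theorem crossVertex_injective (k : ℕ) : Function.Injective (crossVertex k) := by
  rintro ⟨i, a⟩ ⟨j, b⟩ h
  have hi := congrArg (fun w => w i) h
  by_cases hij : i = j
  · subst hij
    cases a <;> cases b <;> simp [crossVertex] at hi ⊢ <;> linarith
  · cases a <;> simp [crossVertex, hij] at hi

/-- The constant DMS of the `2 (k + 1)` vertices of the cross-polytope in `ℝ^(k+1)`. -/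
noncomputable def crossPolytopeDMS (k : ℕ) : DMS :=
  DMS.ofTrajectories (fun v (_ : ℝ) => crossVertex k v) (fun _ => continuous_const)
    ⟨0, crossVertex_injective k⟩

/-- The DMS obtained by replacing the still point `+ e_1` (first basis vector) by the oscillating
point `(1 + sin² t) e_1`. -/
noncomputable def oscillatingDMS (k : ℕ) : DMS :=
  DMS.ofTrajectories
    (fun v (t : ℝ) => if v = (0, true) then (1 + Real.sin t ^ 2) • crossVertex k v
      else crossVertex k v)
    (fun v => by
      by_cases h : v = (0, true)
      · simp only [h, if_true]; fun_prop
      · simp only [h, if_false]; fun_prop)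
    ⟨0, by simpa using crossVertex_injective k⟩

end Example

/-! At scale √2 the still vertices span the boundary of the cross-polytope, a `k`-sphere: the
homology is `F` at all times with identity maps, and one bar is the whole line. The moving point is
at `+ e_1` exactly when `sin t = 0`; at other times all its distances to other points exceed √2, so
it is an isolated vertex and no non-zero `k`-cycle is left. The homology of the second filtration
thus lives only at the multiples of π, and each of its bars is a single point. The full line must be
matched, but lies in no thickening of a point. The interleaving distance does not see this: it only
asks that small distances recur within time `ε`, and every time is within π/2 of a zero of the sine.

The homology is computed by hand. There are no `(k + 1)`-simplices, so it is the space of cycles. A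
cycle changes sign when one vertex is replaced by its antipode, so it is determined by one
coefficient (`cycle_eq_zero`), and a signed determinant (`fundamentalCycle`) attains the value 1
there. The same rigidity kills the cycles of the pinched complex.

No uniqueness of interval decompositions is needed: `exists_carrier_eq_univ` and
`notMem_of_subsingleton` apply to any decomposition, over any indexing set. -/

/-! ## Homology of the cross-polytope -/

section CrossPolytopeHomology

/-- The boundary complex of the `(k + 1)`-dimensional cross-polytope: the simplices are the
non-empty sets of vertices without antipodal pairs. -/
def crossComplex (k : ℕ) : PreAbstractSimplicialComplex (Fin (k + 1) × Bool) where
  faces := {σ | σ.Nonempty ∧ ∀ x ∈ σ, ∀ y ∈ σ, x.1 = y.1 → x = y}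
  isRelLowerSet_faces := fun _ hσ =>
    ⟨hσ.1, fun _ hle hne => ⟨hne, fun x hx y hy => hσ.2 x (hle hx) y (hle hy)⟩⟩

/-- The subcomplex of `crossComplex k` in which the vertex `+ e_1` is isolated. -/
def pinchedComplex (k : ℕ) : PreAbstractSimplicialComplex (Fin (k + 1) × Bool) where
  faces := {σ | σ.Nonempty ∧ ∀ x ∈ σ, ∀ y ∈ σ, (x.1 = y.1 ∨ x = (0, true)) → x = y}
  isRelLowerSet_faces := fun _ hσ =>
    ⟨hσ.1, fun _ hle hne => ⟨hne, fun x hx y hy => hσ.2 x (hle hx) y (hle hy)⟩⟩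

theorem pinchedComplex_le (k : ℕ) : pinchedComplex k ≤ crossComplex k :=
  fun _ hσ => ⟨hσ.1, fun x hx y hy h => hσ.2 x hx y hy (Or.inl h)⟩

/-- The edge from `+ e_1` to `+ e_2` is lost, which needs a second axis; for `k = 0` the complexes
agree. This makes the zeros of the sine genuine critical points. -/
theorem pinchedComplex_ne {k : ℕ} (hk : 1 ≤ k) : pinchedComplex k ≠ crossComplex k := by
  intro h
  have h1 : (1 : Fin (k + 1)) ≠ 0 := by
    rw [Ne, Fin.ext_iff, Fin.val_one', Fin.val_zero, Nat.mod_eq_of_lt (by omega)]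
    omega
  have hmem : ({(0, true), (1, true)} : Finset (Fin (k + 1) × Bool)) ∈ (crossComplex k).faces := by
    refine ⟨by simp, ?_⟩
    simp [h1, h1.symm]
  rw [← h] at hmem
  have := hmem.2 (0, true) (by simp) (1, true) (by simp) (Or.inr rfl)
  exact h1 (congrArg Prod.fst this).symm

variable (F : Type*) [Field F]

variable {F} in
-- A simplex has no antipodal pair, so it uses each axis at most once.
theorem fst_injective_of_simplicialChains {k n : ℕ} {c : (Fin (n + 1) → Fin (k + 1) × Bool) → F}
    (hc : c ∈ simplicialChains F (crossComplex k) n) {x : Fin (n + 1) → Fin (k + 1) × Bool}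
    (hx : c x ≠ 0) : Function.Injective fun i => (x i).1 := by
  obtain ⟨hi, s, hs, hr⟩ := hc.2 x hx
  have hmem : ∀ i, x i ∈ s := fun i => by
    rw [← Finset.mem_coe, hr]
    exact Set.mem_range_self i
  exact fun i j hij => hi (hs.2 _ (hmem i) _ (hmem j) hij)

/-- Pigeonhole: a `(k + 1)`-simplex would need `k + 2` different axes. -/
theorem simplicialBoundaries_crossComplex (k : ℕ) :
    simplicialBoundaries F (crossComplex k) k = ⊥ := by
  have h : simplicialChains F (crossComplex k) (k + 1) = ⊥ := by
    refine (Submodule.eq_bot_iff _).mpr fun c hc => ?_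
    funext x
    by_contra hx
    have := Fintype.card_le_of_injective _ (fst_injective_of_simplicialChains hc hx)
    simp at this
  rw [simplicialBoundaries, h, Submodule.map_bot]

variable {F}

/-- In a top-dimensional cycle, antipodal vertices in the first position have opposite
coefficients. -/
theorem cycle_cons_add_cons {k : ℕ} {c : (Fin (k + 2) → Fin (k + 2) × Bool) → F}
    (hc : c ∈ simplicialCycles F (crossComplex (k + 1)) (k + 1)) (i : Fin (k + 2))
    (y : Fin (k + 1) → Fin (k + 2) × Bool) (hy : ∀ j, (y j).1 ≠ i) :
    c (Fin.cons (i, true) y) + c (Fin.cons (i, false) y) = 0 := by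
  have h0 : ∑ v, c (Fin.cons v y) = 0 := congrFun (LinearMap.mem_ker.mp hc.2) y
  -- In the boundary coefficient at `y`, a non-zero term uses every axis; since `y` avoids axis `i`,
  -- the added vertex must lie on it.
  rw [Fintype.sum_prod_type, Finset.sum_eq_single i] at h0
  · simpa using h0
  · intro j _ hj
    refine Finset.sum_eq_zero fun b _ => ?_
    by_contra hne
    have h1 := fst_injective_of_simplicialChains hc.1 hne
    have h2 := (Finite.injective_iff_surjective.mp h1) i
    obtain ⟨l, hl⟩ := h2
    induction l using Fin.cases with
    | zero => exact hj (by simpa using hl)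
    | succ l => exact hy l (by simpa using hl)
  · simp

/-- By alternation, position `j` can be moved to the front, where antipodal coefficients cancel. So
the sign of any one vertex can be made positive without affecting whether the coefficient vanishes.
-/
theorem cycle_eq_zero_of_update {k : ℕ} {c : (Fin (k + 2) → Fin (k + 2) × Bool) → F}
    (hc : c ∈ simplicialCycles F (crossComplex (k + 1)) (k + 1))
    {x : Fin (k + 2) → Fin (k + 2) × Bool} (j : Fin (k + 2))
    (h : c (Function.update x j ((x j).1, true)) = 0) : c x = 0 := by
  by_contra hx
  have hinj := fst_injective_of_simplicialChains hc.1 hx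
  set y : Fin (k + 1) → Fin (k + 2) × Bool := Fin.tail (x ∘ Equiv.swap 0 j) with hy
  have hcons : ∀ v, Function.update x j v ∘ Equiv.swap 0 j = Fin.cons v y := by
    intro v
    funext l
    induction l using Fin.cases with
    | zero => simp
    | succ l =>
      have : Equiv.swap 0 j l.succ ≠ j := by
        intro h
        have h' := congrArg (Equiv.swap 0 j) h
        rw [Equiv.swap_apply_self, Equiv.swap_apply_right] at h'
        exact Fin.succ_ne_zero l h'
      simp [hy, Fin.tail, this]
  have hyi : ∀ l, (y l).1 ≠ (x j).1 := by
    intro l hl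
    have h' := congrArg (Equiv.swap 0 j) (hinj hl)
    rw [Equiv.swap_apply_self, Equiv.swap_apply_right] at h'
    exact Fin.succ_ne_zero l h'
  have hadd := cycle_cons_add_cons hc (x j).1 y hyi
  rw [← hcons, ← hcons, hc.1.1, hc.1.1, h, mul_zero, zero_add] at hadd
  have hs : ((Equiv.Perm.sign (Equiv.swap 0 j) : ℤ) : F) ≠ 0 := by
    rcases Int.units_eq_one_or (Equiv.Perm.sign (Equiv.swap 0 j)) with h | h <;> simp [h]
  have h2 := (mul_eq_zero.mp hadd).resolve_left hs
  rcases hb : (x j).2 with _ | _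
  · exact hx (by rwa [← hb, Prod.mk.eta, Function.update_eq_self] at h2)
  · exact hx (by rwa [← hb, Prod.mk.eta, Function.update_eq_self] at h)

/-- A top-dimensional cycle is determined by its coefficient at `[e_1, …, e_{k+2}]`. -/
theorem cycle_eq_zero {k : ℕ} {c : (Fin (k + 2) → Fin (k + 2) × Bool) → F}
    (hc : c ∈ simplicialCycles F (crossComplex (k + 1)) (k + 1))
    (h : c (fun i => (i, true)) = 0) : c = 0 := by
  -- Induction on a set of positions that contains all negative vertices, made positive one at a
  -- time.
  have key : ∀ (s : Finset (Fin (k + 2))) (b : Fin (k + 2) → Bool), (∀ i ∉ s, b i = true) →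
      c (fun i => (i, b i)) = 0 := by
    intro s
    induction s using Finset.induction_on with
    | empty =>
      intro b hb
      rw [← h]
      congr 1
      funext i
      rw [hb i (Finset.notMem_empty i)]
    | insert a s _ ih =>
      intro b hb
      refine cycle_eq_zero_of_update hc a ?_
      rw [← ih (Function.update b a true)]
      · congr 1
        funext i
        by_cases hi : i = a
        · subst hi; simp
        · simp [hi]
      · intro i hi
        by_cases hia : i = a
        · subst hia; simp
        · simp [hia, hb i (by simp [hia, hi])]
  funext x
  by_contra hx
  have hinj := fst_injective_of_simplicialChains hc.1 hx
  -- The axes of `x` form a permutation; alternation sorts them into the standard order.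
  let π : Equiv.Perm (Fin (k + 2)) :=
    Equiv.ofBijective _ (Finite.injective_iff_bijective.mp hinj)
  have h1 : x = (fun i => (i, (x (π.symm i)).2)) ∘ π := by
    funext i
    refine Prod.ext rfl ?_
    simp
  have h2 := key Finset.univ (fun i => (x (π.symm i)).2) (by simp)
  rw [h1, hc.1.1, h2, mul_zero] at hx
  exact hx rfl

variable (F) in
/-- The fundamental cycle of the boundary of the cross-polytope. -/
def fundamentalCycle (k : ℕ) (x : Fin (k + 1) → Fin (k + 1) × Bool) : F :=
  (∏ i, if (x i).2 then 1 else -1) *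
    Matrix.detRowAlternating fun i => Pi.single (x i).1 (1 : F)

/-- The determinant gives alternation and vanishes on a repeated axis. Replacing the first vertex by
its antipode flips the product of signs but not the determinant, so the boundary cancels in pairs,
in every characteristic. -/
theorem fundamentalCycle_mem (k : ℕ) :
    fundamentalCycle F (k + 1) ∈ simplicialCycles F (crossComplex (k + 1)) (k + 1) := by
  refine ⟨⟨fun π x => ?_, fun x hx => ?_⟩, ?_⟩
  · have h := (Matrix.detRowAlternating (R := F) (n := Fin (k + 2))).map_perm
      (fun i => Pi.single (x i).1 (1 : F)) π
    have h' := Equiv.prod_comp π fun i => if (x i).2 then (1 : F) else -1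
    simp only [fundamentalCycle, Function.comp_def] at h h' ⊢
    rw [h, h', Units.smul_def, zsmul_eq_mul]
    ring
  · have hinj : Function.Injective fun i => (x i).1 := by
      intro i j hij
      by_contra hne
      refine right_ne_zero_of_mul hx (AlternatingMap.map_eq_zero_of_eq _ _ ?_ hne)
      simp only at hij
      rw [hij]
    refine ⟨fun i j hij => hinj (congrArg Prod.fst hij), Finset.univ.image x,
      ⟨by simp, ?_⟩, by simp⟩
    simp only [Finset.mem_image, Finset.mem_univ, true_and]
    rintro _ ⟨i, rfl⟩ _ ⟨j, rfl⟩ hij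
    exact congrArg x (hinj hij)
  · refine LinearMap.mem_ker.mpr ?_
    funext y
    change ∑ v, fundamentalCycle F (k + 1) (Fin.cons v y) = 0
    rw [Fintype.sum_prod_type]
    refine Finset.sum_eq_zero fun i _ => ?_
    have hdet : ∀ b : Bool, (fun j => Pi.single (M := fun _ => F)
        ((Fin.cons (i, b) y : Fin (k + 2) → Fin (k + 2) × Bool) j).1 1) =
        Fin.cons (Pi.single i 1) fun j => Pi.single (y j).1 1 := by
      intro b
      funext j
      induction j using Fin.cases <;> simp
    simp [fundamentalCycle, hdet, Fin.prod_univ_succ]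

theorem fundamentalCycle_apply (k : ℕ) : fundamentalCycle F k (fun i => (i, true)) = 1 := by
  have : (fun i : Fin (k + 1) => Pi.single i (1 : F)) = (1 : Matrix _ _ F) := by
    funext i j
    simp [Matrix.one_apply, Pi.single_apply, eq_comm]
  simp only [fundamentalCycle, this]
  simp only [if_true, Finset.prod_const_one, one_mul]
  exact Matrix.det_one

variable (F) in
/-- The coefficient at `[e_1, …, e_{k+2}]` identifies the top-dimensional cycles with `F`. -/
noncomputable def cyclesEquiv (k : ℕ) :
    simplicialCycles F (crossComplex (k + 1)) (k + 1) ≃ₗ[F] F :=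
  LinearEquiv.ofBijective
    (LinearMap.proj (fun i => (i, true)) ∘ₗ Submodule.subtype _)
    ⟨(injective_iff_map_eq_zero _).mpr fun c hc => Subtype.ext (cycle_eq_zero c.2 hc),
      fun a => ⟨a • ⟨fundamentalCycle F (k + 1), fundamentalCycle_mem k⟩, by
        simp [fundamentalCycle_apply]⟩⟩

variable (F) in
theorem nonempty_homology_crossComplex_equiv {k : ℕ} (hk : 1 ≤ k) :
    Nonempty (SimplicialHomology F (crossComplex k) k ≃ₗ[F] F) := by
  obtain ⟨k, rfl⟩ := Nat.exists_eq_add_of_le' hk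
  refine ⟨Submodule.quotEquivOfEqBot _ ?_ ≪≫ₗ cyclesEquiv F k⟩
  rw [simplicialBoundaries_crossComplex, Submodule.submoduleOf, Submodule.comap_bot,
    Submodule.ker_subtype]

variable (F) in
-- A cycle here is a cycle of the cross-polytope whose coefficient at the positive facet is zero,
-- because that facet joins `+ e_1` to another vertex.
theorem subsingleton_homology_pinchedComplex {k : ℕ} (hk : 1 ≤ k) :
    Subsingleton (SimplicialHomology F (pinchedComplex k) k) := by
  obtain ⟨k, rfl⟩ := Nat.exists_eq_add_of_le' hk
  have : Subsingleton (simplicialCycles F (pinchedComplex (k + 1)) (k + 1)) := by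
    refine subsingleton_of_forall_eq 0 fun c => Subtype.ext ?_
    refine cycle_eq_zero (simplicialCycles_mono F (pinchedComplex_le _) _ c.2) ?_
    by_contra hne
    obtain ⟨-, s, hs, hr⟩ := c.2.1.2 _ hne
    have hmem : ∀ i, (i, true) ∈ s := fun i => by
      rw [← Finset.mem_coe, hr]
      exact Set.mem_range_self i
    have := hs.2 _ (hmem 0) _ (hmem 1) (Or.inr rfl)
    simp at this
  exact Quotient.instSubsingletonQuotient _

end CrossPolytopeHomology

/-! ## Interval decompositions of zigzag modules -/

namespace ZZ

theorem s_le_c (i : ℤ) : s i ≤ c i :=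
  Prod.le_def.mpr ⟨OrderDual.toDual_le_toDual.mpr (show i ≤ i + 1 by omega), le_rfl⟩

theorem s_le_c_succ (i : ℤ) : s i ≤ c (i + 1) :=
  Prod.le_def.mpr ⟨le_rfl, show i ≤ i + 1 by omega⟩

/-- A subset of the zigzag poset that is closed under passing to comparable elements is empty or
everything. -/
theorem forall_of_comparable {p : ZZ → Prop} (h0 : p (c 0))
    (h : ∀ x y : ZZ, x ≤ y → (p x ↔ p y)) (x : ZZ) : p x := by
  have hc : ∀ i, p (c i) := by
    intro i
    induction i using Int.induction_on with
    | zero => exact h0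
    | succ i ih => exact (h _ _ (s_le_c_succ i)).mp ((h _ _ (s_le_c i)).mpr ih)
    | pred i ih =>
      have h1 := s_le_c_succ (-(i : ℤ) - 1)
      rw [sub_add_cancel] at h1
      exact (h _ _ (s_le_c _)).mp ((h _ _ h1).mpr ih)
  cases x with
  | c i => exact hc i
  | s i => exact (h _ _ (s_le_c i)).mpr (hc i)

end ZZ

namespace PosetInterval

/-- The whole zigzag poset as an interval. -/
def zzUniv : PosetInterval ZZ where
  carrier := Set.univ
  nonempty := ⟨ZZ.c 0, trivial⟩
  convex _ _ _ _ _ _ _ := trivial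
  connected x _ y _ := by
    have hsymm : Std.Symm fun a b : ZZ => a ∈ Set.univ ∧ b ∈ Set.univ ∧ (a ≤ b ∨ b ≤ a) :=
      ⟨fun a b h => ⟨h.2.1, h.1, h.2.2.symm⟩⟩
    -- By symmetry it is enough to connect every element to `c 0`.
    have h : ∀ z : ZZ, Relation.ReflTransGen
        (fun a b => a ∈ Set.univ ∧ b ∈ Set.univ ∧ (a ≤ b ∨ b ≤ a)) (ZZ.c 0) z :=
      ZZ.forall_of_comparable Relation.ReflTransGen.refl fun a b hab =>
        ⟨fun h => h.tail ⟨trivial, trivial, Or.inl hab⟩,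
          fun h => h.tail ⟨trivial, trivial, Or.inr hab⟩⟩
    exact (Std.Symm.symm _ _ (h x)).trans (h y)

/-- A one-point interval. -/
def point {P : Type} [PartialOrder P] (p : P) : PosetInterval P where
  carrier := {p}
  nonempty := ⟨p, rfl⟩
  convex := by
    rintro r s t rfl rfl h h'
    exact le_antisymm h' h
  connected := by
    rintro s rfl t rfl
    exact Relation.ReflTransGen.refl

/-- An interval of the zigzag poset that contains no `s i` has at most one element. -/
theorem subsingleton_of_s_notMem {J : PosetInterval ZZ} (h : ∀ i, ZZ.s i ∉ J.carrier) :
    J.carrier.Subsingleton := by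
  -- Every `c i` is maximal, so a comparability path that avoids all `s i` cannot move.
  have hle : ∀ p ∈ J.carrier, ∀ q, p ≤ q → p = q := by
    intro p hp q hpq
    rcases ZZ.le_cases hpq with rfl | ⟨i, rfl, -⟩
    · rfl
    · exact absurd hp (h i)
  intro p hp q hq
  have := J.connected p hp q hq
  induction this with
  | refl => rfl
  | tail _ hbc ih =>
    rcases hbc.2.2 with hle' | hle'
    · exact (ih hbc.1).trans (hle _ hbc.1 _ hle')
    · exact (ih hbc.1).trans (hle _ hbc.2.1 _ hle').symm

end PosetInterval

section Decompositions

universe u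

variable {F : Type u} [Field F] {P : Type} [PartialOrder P] {ι : Type}

/-- If `i` is the index of the only interval that contains `p`, the direct sum of the interval
modules is one-dimensional at `p`. -/
noncomputable def intervalSumEquiv (J : ι → PosetInterval P) (p : P) (i : ι)
    (h : ∀ j, p ∈ (J j).carrier ↔ j = i) : (⨁ j, intervalSpace F (J j) p) ≃ₗ[F] F :=
  LinearEquiv.ofBijective
    (Submodule.subtype _ ∘ₗ DirectSum.component F ι (fun j => intervalSpace F (J j) p) i) (by
      classical
      refine ⟨(injective_iff_map_eq_zero _).mpr fun x hx => ?_, fun a => ?_⟩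
      · refine DFinsupp.ext fun j => Subtype.ext ?_
        by_cases hj : j = i
        · subst hj; exact hx
        · exact (x j).2 (mt (h j).mp hj)
      · refine ⟨DirectSum.lof F ι (fun j => intervalSpace F (J j) p) i
          ⟨a, fun hn => absurd ((h i).mpr rfl) hn⟩, ?_⟩
        simp [DirectSum.component.lof_self])

theorem subsingleton_intervalSum_obj (J : ι → PosetInterval P) (p : P)
    (h : ∀ j, p ∉ (J j).carrier) : Subsingleton (⨁ j, intervalSpace F (J j) p) :=
  subsingleton_of_forall_eq 0 fun x => DFinsupp.ext fun j => Subtype.ext ((x j).2 (h j))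

/-- A zigzag module all of whose maps are compatible with identifications with `F` is the interval
module of the whole zigzag poset. -/
theorem nonempty_iso_intervalSum_zzUniv (M : ZZ ⥤ ModuleCat.{u} F) (φ : ∀ p, M.obj p ≃ₗ[F] F)
    (hφ : ∀ {p q : ZZ} (f : p ⟶ q) (x : M.obj p), φ q ((M.map f).hom x) = φ p x) :
    Nonempty (M ≅ intervalSum F fun _ : Unit => PosetInterval.zzUniv) := by
  let ψ : ∀ p, ((intervalSum F fun _ : Unit => PosetInterval.zzUniv).obj p) ≃ₗ[F] F := fun p =>
    intervalSumEquiv (fun _ : Unit => PosetInterval.zzUniv) p ()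
      fun j => ⟨fun _ => rfl, fun _ => trivial⟩
  have hψ : ∀ {p q : ZZ} (f : p ⟶ q) x,
      ψ q (((intervalSum F fun _ : Unit => PosetInterval.zzUniv).map f).hom x) = ψ p x := by
    intro p q f x
    exact if_pos ⟨trivial, trivial⟩
  refine ⟨CategoryTheory.NatIso.ofComponents (fun p => ((φ p).trans (ψ p).symm).toModuleIso) ?_⟩
  intro p q f
  ext x
  -- Both sides are compared in `F`, where all structure maps become the identity.
  refine (ψ q).injective ?_
  refine Eq.trans ?_ (hψ f ((ψ p).symm (φ p x))).symm
  refine ((ψ q).apply_symm_apply (φ q ((M.map f).hom x))).trans ?_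
  rw [hφ, LinearEquiv.apply_symm_apply]

/-- A zigzag module that is zero at every `s i` and one-dimensional at every `c i` is the direct
sum of the interval modules of the points `c i`. -/
theorem nonempty_iso_intervalSum_points (M : ZZ ⥤ ModuleCat.{u} F)
    (hs : ∀ i, Subsingleton (M.obj (ZZ.s i))) (hc : ∀ i, Nonempty (M.obj (ZZ.c i) ≃ₗ[F] F)) :
    Nonempty (M ≅ intervalSum F fun i : ℤ => PosetInterval.point (ZZ.c i)) := by
  have h : ∀ p, Nonempty
      (M.obj p ≃ₗ[F] (intervalSum F fun i : ℤ => PosetInterval.point (ZZ.c i)).obj p) := by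
    intro p
    cases p with
    | c i =>
      obtain ⟨φ⟩ := hc i
      refine ⟨φ.trans (intervalSumEquiv _ _ i fun j => ?_).symm⟩
      exact ⟨fun h => by injection h with h; exact h.symm, fun h => h ▸ rfl⟩
    | s i =>
      have := hs i
      have : Subsingleton
          ((intervalSum F fun i : ℤ => PosetInterval.point (ZZ.c i)).obj (ZZ.s i)) :=
        subsingleton_intervalSum_obj _ _ fun j h => by cases h
      exact ⟨0, 0, fun _ => Subsingleton.elim _ _, fun _ => Subsingleton.elim _ _⟩
  refine ⟨CategoryTheory.NatIso.ofComponents (fun p => (h p).some.toModuleIso) ?_⟩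
  intro p q f
  -- Naturality is free for arbitrary pointwise isomorphisms: every non-identity arrow starts at
  -- some `s i`, where the module is zero.
  rcases ZZ.le_cases (CategoryTheory.leOfHom f) with rfl | ⟨i, rfl, -⟩
  · obtain rfl : f = 𝟙 p := Subsingleton.elim _ _
    simp
  · ext x
    have := hs i
    rw [Subsingleton.elim x 0, map_zero, map_zero]

/-- A module with a decomposition into interval modules vanishes at `p` only if no interval
contains `p`. -/
theorem notMem_of_subsingleton {M : P ⥤ ModuleCat.{u} F} {J : ι → PosetInterval P}
    (e : M ≅ intervalSum F J) {p : P} (h : Subsingleton (M.obj p)) (j : ι) :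
    p ∉ (J j).carrier := by
  classical
  intro hp
  have hsub : Subsingleton (⨁ j, intervalSpace F (J j) p) :=
    (e.app p).symm.toLinearEquiv.toEquiv.subsingleton
  -- Otherwise the generator of the `j`-th summand at `p` would be zero.
  have h1 := congrArg (fun x => (x j).1) (Subsingleton.elim
    (DirectSum.lof F ι (fun j => intervalSpace F (J j) p) j ⟨1, fun hn => absurd hp hn⟩) 0)
  simp [DirectSum.lof_apply] at h1

/-- Any interval decomposition of a non-zero zigzag module whose maps are isomorphisms contains
the whole zigzag poset. -/
theorem exists_carrier_eq_univ {M : ZZ ⥤ ModuleCat.{u} F} {J : ι → PosetInterval ZZ}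
    (e : M ≅ intervalSum F J) (h0 : Nontrivial (M.obj (ZZ.c 0)))
    (hM : ∀ {p q : ZZ} (f : p ⟶ q), CategoryTheory.IsIso (M.map f)) :
    ∃ j, (J j).carrier = Set.univ := by
  have hmem : ∃ j, ZZ.c 0 ∈ (J j).carrier := by
    by_contra hno
    push Not at hno
    have : Subsingleton ((intervalSum F J).obj (ZZ.c 0)) := subsingleton_intervalSum_obj J _ hno
    have := (e.app (ZZ.c 0)).toLinearEquiv.toEquiv.subsingleton
    exact not_subsingleton _ this
  obtain ⟨j, hj⟩ := hmem
  refine ⟨j, Set.eq_univ_of_forall (ZZ.forall_of_comparable hj fun p q hpq => ?_)⟩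
  have hiso : CategoryTheory.IsIso ((intervalSum F J).map (CategoryTheory.homOfLE hpq)) :=
    (CategoryTheory.NatIso.isIso_map_iff e _).mp (hM _)
  -- A bijective direct sum of maps is bijective on each summand, so the `j`-th map cannot go
  -- between `F` and `0`: membership in `J j` passes between comparable elements.
  have hbij : Function.Bijective
      (DirectSum.lmap fun j => intervalMap F (J j) p q) :=
    (CategoryTheory.ConcreteCategory.isIso_iff_bijective _).mp hiso
  constructor
  · intro hp
    by_contra hq
    have h1 := @(DirectSum.lmap_injective _).mp hbij.1 j ⟨1, fun hn => absurd hp hn⟩ 0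
      (Subtype.ext (by simp [intervalMap, hq]))
    exact one_ne_zero (congrArg Subtype.val h1)
  · intro hq
    by_contra hp
    obtain ⟨a, ha⟩ := (DirectSum.lmap_surjective _).mp hbij.2 j ⟨1, fun hn => absurd hq hn⟩
    have h1 := congrArg Subtype.val ha
    simp [intervalMap, hp] at h1

end Decompositions

/-! ## Barcodes -/

namespace IndexingSet

variable {X : Type} {f : ℝ → PreAbstractSimplicialComplex X} (K : IndexingSet f)

theorem realInterval_eq_univ {J : PosetInterval ZZ} (hJ : J.carrier = Set.univ) :
    K.realInterval J = Set.univ := by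
  refine Set.eq_univ_of_forall fun t => ?_
  obtain ⟨i, hi⟩ := (K.tendsto_atBot.eventually (Filter.eventually_le_atBot t)).exists
  obtain ⟨b, hb⟩ := (K.tendsto_atTop.eventually (Filter.eventually_gt_atTop t)).exists
  -- With `m` the last index such that `c m ≤ t`, the time `t` is `c m` or lies in the gap after it.
  obtain ⟨m, hm, hmax⟩ := Int.exists_greatest_of_bdd (P := fun i => K.c i ≤ t)
    ⟨b, fun z hz => (K.strictMono_c.lt_iff_lt.mp (hz.trans_lt hb)).le⟩ ⟨i, hi⟩
  have hlt : t < K.c (m + 1) := by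
    by_contra hn
    have := hmax (m + 1) (not_lt.mp hn)
    omega
  rcases hm.eq_or_lt with h | h
  · exact Or.inl (Set.mem_iUnion₂.mpr ⟨m, by rw [hJ]; trivial, h.symm⟩)
  · exact Or.inr (Set.mem_iUnion₂.mpr ⟨m, by rw [hJ]; trivial, h, hlt⟩)

theorem realInterval_point (i : ℤ) : K.realInterval (PosetInterval.point (ZZ.c i)) = {K.c i} := by
  ext t
  simp [realInterval, PosetInterval.point]

theorem realInterval_subsingleton {J : PosetInterval ZZ} (hJ : ∀ i, ZZ.s i ∉ J.carrier) :
    (K.realInterval J).Subsingleton := by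
  intro t ht u hu
  simp only [realInterval, hJ, Set.mem_union, Set.mem_iUnion, Set.mem_singleton_iff, exists_prop,
    false_and, exists_false, or_false] at ht hu
  obtain ⟨i, hi, rfl⟩ := ht
  obtain ⟨j, hj, rfl⟩ := hu
  have := PosetInterval.subsingleton_of_s_notMem hJ hi hj
  injection this with h
  rw [h]

end IndexingSet

theorem Barcode.bottleneckDist_eq_top {A B : Barcode} {a : A.ι} (ha : A.I a = Set.univ)
    (hB : ∀ b, (B.I b).Subsingleton) : A.bottleneckDist B = ⊤ := by
  refine iInf₂_eq_top.mpr fun δ hδ => ?_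
  obtain ⟨σ, hσ⟩ := hδ
  obtain ⟨b, hb⟩ := hσ.coim a ⟨0, by rw [ha]; exact Set.subset_univ _⟩
  obtain ⟨r, hr⟩ := B.nonempty b
  -- A point too far from `r` for the `δ`-thickening of the partner `{r}`.
  have h : r + δ + 1 ∈ A.I a := by rw [ha]; trivial
  obtain ⟨u, hu, hle⟩ := (hσ.close a b hb).1 h
  rw [hB b hu hr] at hle
  have := (le_abs_self _).trans hle
  linarith

/-! ## Level sets of the squared sine -/

theorem finite_range_int_mul_pi_add_inter (b : ℝ) {I : Set ℝ} (hI : Bornology.IsBounded I) :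
    (Set.range (fun n : ℤ => n * Real.pi + b) ∩ I).Finite := by
  obtain ⟨lo, hlo⟩ := hI.bddBelow
  obtain ⟨hi, hhi⟩ := hI.bddAbove
  refine ((Set.finite_Icc ⌊(lo - b) / Real.pi⌋ ⌈(hi - b) / Real.pi⌉).image
    fun n : ℤ => n * Real.pi + b).subset ?_
  rintro _ ⟨⟨n, rfl⟩, hn⟩
  refine ⟨n, ⟨?_, ?_⟩, rfl⟩
  · refine Int.cast_le.mp ((Int.floor_le _).trans ((div_le_iff₀ Real.pi_pos).mpr ?_))
    have := hlo hn
    dsimp only at this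
    linarith
  · refine Int.cast_le.mp (((le_div_iff₀ Real.pi_pos).mpr ?_).trans (Int.le_ceil _))
    have := hhi hn
    dsimp only at this
    linarith

/-- Equality of squared sines is `cos 2t = cos 2u`, that is, `t = nπ ± u`. This serves both tameness
and, with `u = 0`, local finiteness of the critical points. -/
theorem finite_sin_sq_eq_inter (u : ℝ) {I : Set ℝ} (hI : Bornology.IsBounded I) :
    ({t | Real.sin t ^ 2 = Real.sin u ^ 2} ∩ I).Finite := by
  refine ((finite_range_int_mul_pi_add_inter u hI).union
    (finite_range_int_mul_pi_add_inter (-u) hI)).subset ?_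
  rintro t ⟨ht, htI⟩
  have hcos : Real.cos (2 * u) = Real.cos (2 * t) := by
    rw [Real.cos_two_mul, Real.cos_two_mul, Real.cos_sq', Real.cos_sq', ht]
  obtain ⟨n, h | h⟩ := Real.cos_eq_cos_iff.mp hcos
  · exact Or.inl ⟨⟨n, by dsimp only; linarith⟩, htI⟩
  · exact Or.inr ⟨⟨n, by dsimp only; linarith⟩, htI⟩

theorem TameFunction.const (a : ℝ) : TameFunction fun _ => a := by
  refine ⟨continuous_const, fun c I hI _ => ?_⟩
  by_cases h : a = c
  · have : PreconnectedSpace ↥((fun _ : ℝ => a) ⁻¹' {c} ∩ I) := by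
      refine Subtype.preconnectedSpace ?_
      rw [Set.preimage_const_of_mem (Set.mem_singleton_iff.mpr h), Set.univ_inter]
      exact hI.isPreconnected
    have : Subsingleton (ConnectedComponents ↥((fun _ : ℝ => a) ⁻¹' {c} ∩ I)) := inferInstance
    exact Finite.of_subsingleton
  · have : IsEmpty ↥((fun _ : ℝ => a) ⁻¹' {c} ∩ I) := ⟨fun x => h x.2.1⟩
    exact Quotient.finite _

theorem TameFunction.of_sin_sq {f : ℝ → ℝ} (hf : Continuous f)
    (h : ∀ t u, f t = f u → Real.sin t ^ 2 = Real.sin u ^ 2) : TameFunction f := by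
  refine ⟨hf, fun c I _ hb => ?_⟩
  have hfin : (f ⁻¹' {c} ∩ I).Finite := by
    rcases (f ⁻¹' {c} ∩ I).eq_empty_or_nonempty with he | ⟨u, hu⟩
    · rw [he]
      exact Set.finite_empty
    · refine (finite_sin_sq_eq_inter u hb).subset ?_
      rintro t ⟨ht, htI⟩
      exact ⟨h t u (ht.trans hu.1.symm), htI⟩
  have := hfin.to_subtype
  exact Quotient.finite _

/-! ## The distances in the two examples -/

section Distances

theorem norm_single_sub_single {n : ℕ} (i j : Fin n) (a b : ℝ) :
    ‖EuclideanSpace.single i a - EuclideanSpace.single j b‖ =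
      if i = j then |a - b| else Real.sqrt (a ^ 2 + b ^ 2) := by
  split_ifs with h
  · subst h
    rw [← dist_eq_norm, PiLp.dist_single_same, Real.dist_eq]
  · rw [eq_comm, Real.sqrt_eq_iff_eq_sq (by positivity) (norm_nonneg _), norm_sub_sq_real,
      EuclideanSpace.inner_single_left]
    simp [h]

/-- The signed distance from the origin of the points of `oscillatingDMS`. -/
noncomputable def oscillatingCoord {k : ℕ} (t : ℝ) (v : Fin (k + 1) × Bool) : ℝ :=
  if v = (0, true) then 1 + Real.sin t ^ 2 else if v.2 then 1 else -1

/-- The distances of `oscillatingDMS`. -/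
noncomputable def oscillatingDist {k : ℕ} (t : ℝ) (x y : Fin (k + 1) × Bool) : ℝ :=
  (oscillatingDMS k).dist t x y

variable {k : ℕ}

theorem oscillatingDist_self (t : ℝ) (x : Fin (k + 1) × Bool) : oscillatingDist t x x = 0 :=
  (oscillatingDMS k).dist_self t x

theorem oscillatingDist_comm (t : ℝ) (x y : Fin (k + 1) × Bool) :
    oscillatingDist t x y = oscillatingDist t y x :=
  (oscillatingDMS k).dist_comm t x y

theorem oscillatingCoord_of_ne (t : ℝ) {v : Fin (k + 1) × Bool} (hv : v ≠ (0, true)) :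
    oscillatingCoord t v = if v.2 then 1 else -1 := if_neg hv

theorem oscillatingCoord_false (t : ℝ) (i : Fin (k + 1)) :
    oscillatingCoord t (i, false) = -1 := by
  simp [oscillatingCoord]

theorem oscillatingCoord_zero_true (t : ℝ) :
    oscillatingCoord t ((0, true) : Fin (k + 1) × Bool) = 1 + Real.sin t ^ 2 := if_pos rfl

theorem one_le_oscillatingCoord_true (t : ℝ) (i : Fin (k + 1)) :
    1 ≤ oscillatingCoord t (i, true) := by
  by_cases h : i = 0
  · rw [h, oscillatingCoord_zero_true]
    nlinarith [sq_nonneg (Real.sin t)]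
  · simp [oscillatingCoord, h]

theorem oscillatingCoord_sq_of_ne (t : ℝ) {v : Fin (k + 1) × Bool} (hv : v ≠ (0, true)) :
    oscillatingCoord t v ^ 2 = 1 := by
  rw [oscillatingCoord_of_ne t hv]
  split_ifs <;> norm_num

theorem one_le_oscillatingCoord_sq (t : ℝ) (v : Fin (k + 1) × Bool) :
    1 ≤ oscillatingCoord t v ^ 2 := by
  by_cases h : v = (0, true)
  · rw [h, oscillatingCoord_zero_true]
    nlinarith [sq_nonneg (Real.sin t), sq_nonneg (Real.sin t ^ 2)]
  · exact (oscillatingCoord_sq_of_ne t h).ge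

theorem oscillatingCoord_sq_of_sin_eq_zero {t : ℝ} (ht : Real.sin t = 0)
    (v : Fin (k + 1) × Bool) : oscillatingCoord t v ^ 2 = 1 := by
  by_cases h : v = (0, true)
  · rw [h, oscillatingCoord_zero_true, ht]
    norm_num
  · exact oscillatingCoord_sq_of_ne t h

theorem oscillatingDist_eq (t : ℝ) (x y : Fin (k + 1) × Bool) :
    oscillatingDist t x y = if x.1 = y.1
      then |oscillatingCoord t x - oscillatingCoord t y|
      else Real.sqrt (oscillatingCoord t x ^ 2 + oscillatingCoord t y ^ 2) := by
  have h : ∀ v : Fin (k + 1) × Bool, (if v = (0, true) then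
      (1 + Real.sin t ^ 2) • crossVertex k v else crossVertex k v) =
      EuclideanSpace.single v.1 (oscillatingCoord t v) := by
    intro v
    by_cases hv : v = (0, true)
    · rw [if_pos hv, hv, oscillatingCoord_zero_true]
      ext i
      simp [crossVertex]
    · rw [if_neg hv, oscillatingCoord_of_ne t hv, crossVertex]
  rw [← norm_single_sub_single, ← h, ← h]
  rfl

theorem oscillatingDist_of_sin_eq_zero {u : ℝ} (hu : Real.sin u = 0)
    (x y : Fin (k + 1) × Bool) :
    oscillatingDist u x y = ‖crossVertex k x - crossVertex k y‖ := by
  change ‖(if x = (0, true) then _ else _) - (if y = (0, true) then _ else _)‖ =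
    ‖crossVertex k x - crossVertex k y‖
  simp [hu]

theorem oscillatingDist_antipodal (t : ℝ) (i : Fin (k + 1)) :
    oscillatingDist t (i, true) (i, false) = oscillatingCoord t (i, true) + 1 := by
  have := one_le_oscillatingCoord_true t i
  rw [oscillatingDist_eq, if_pos rfl, oscillatingCoord_false, sub_neg_eq_add, abs_of_nonneg]
  linarith

/-- The moving point only moves outward along its ray, away from every other point, so all distances
are least at time 0. -/
theorem oscillatingDist_zero_le (t : ℝ) (x y : Fin (k + 1) × Bool) :
    oscillatingDist 0 x y ≤ oscillatingDist t x y := by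
  by_cases h : x.1 = y.1
  · have hle : ∀ i : Fin (k + 1), oscillatingCoord 0 (i, true) ≤ oscillatingCoord t (i, true) := by
      intro i
      by_cases h : i = 0
      · rw [h, oscillatingCoord_zero_true, oscillatingCoord_zero_true]
        simp [sq_nonneg]
      · simp [oscillatingCoord, h]
    obtain ⟨i, a⟩ := x
    obtain ⟨j, b⟩ := y
    obtain rfl : i = j := h
    rcases a with _ | _ <;> rcases b with _ | _
    · rw [oscillatingDist_self, oscillatingDist_self]
    · rw [oscillatingDist_comm, oscillatingDist_antipodal, oscillatingDist_comm,
        oscillatingDist_antipodal]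
      linarith [hle i]
    · rw [oscillatingDist_antipodal, oscillatingDist_antipodal]
      linarith [hle i]
    · rw [oscillatingDist_self, oscillatingDist_self]
  · rw [oscillatingDist_eq, oscillatingDist_eq, if_neg h, if_neg h]
    refine Real.sqrt_le_sqrt ?_
    rw [oscillatingCoord_sq_of_sin_eq_zero Real.sin_zero,
      oscillatingCoord_sq_of_sin_eq_zero Real.sin_zero]
    exact add_le_add (one_le_oscillatingCoord_sq t x) (one_le_oscillatingCoord_sq t y)

/-- Distinct points on one axis are antipodal, at distance at least 2. -/
theorem sqrt_two_lt_oscillatingDist_eq (t : ℝ) {x y : Fin (k + 1) × Bool} (h : x.1 = y.1)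
    (hne : x ≠ y) : Real.sqrt 2 < oscillatingDist t x y := by
  have key : ∀ i : Fin (k + 1), Real.sqrt 2 < oscillatingDist t (i, true) (i, false) := by
    intro i
    rw [oscillatingDist_antipodal, Real.sqrt_lt' (by linarith [one_le_oscillatingCoord_true t i])]
    nlinarith [one_le_oscillatingCoord_true t i]
  obtain ⟨i, a⟩ := x
  obtain ⟨j, b⟩ := y
  obtain rfl : i = j := h
  rcases a with _ | _ <;> rcases b with _ | _
  · exact absurd rfl hne
  · rw [oscillatingDist_comm]
    exact key i
  · exact key i
  · exact absurd rfl hne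

theorem sqrt_two_lt_oscillatingDist_zero_true {t : ℝ} (ht : Real.sin t ≠ 0)
    {y : Fin (k + 1) × Bool} (hne : ((0, true) : Fin (k + 1) × Bool) ≠ y) :
    Real.sqrt 2 < oscillatingDist t (0, true) y := by
  by_cases h : ((0, true) : Fin (k + 1) × Bool).1 = y.1
  · exact sqrt_two_lt_oscillatingDist_eq t h hne
  · rw [oscillatingDist_eq, if_neg h, oscillatingCoord_zero_true,
      oscillatingCoord_sq_of_ne t hne.symm]
    refine Real.sqrt_lt_sqrt (by norm_num) ?_
    have : 0 < Real.sin t ^ 2 := by positivity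
    nlinarith

/-! ### Rips complexes at scale √2 -/

theorem oscillatingDMS_rips_of_sin_eq_zero {t : ℝ} (ht : Real.sin t = 0) :
    (oscillatingDMS k).rips (Real.sqrt 2) t = crossComplex k := by
  refine PreAbstractSimplicialComplex.ext
    (Set.ext fun (σ : Finset (Fin (k + 1) × Bool)) => and_congr_right fun _ => ?_)
  change (∀ x ∈ σ, ∀ y ∈ σ, oscillatingDist t x y ≤ Real.sqrt 2) ↔ _
  refine forall₂_congr fun x _ => forall₂_congr fun y _ => ⟨fun h hxy => ?_, fun h => ?_⟩
  · by_contra hne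
    exact (sqrt_two_lt_oscillatingDist_eq t hxy hne).not_ge h
  · by_cases hxy : x.1 = y.1
    · rw [h hxy, oscillatingDist_self]
      positivity
    · rw [oscillatingDist_eq, if_neg hxy, oscillatingCoord_sq_of_sin_eq_zero ht,
        oscillatingCoord_sq_of_sin_eq_zero ht]
      norm_num

theorem oscillatingDMS_rips_of_sin_ne_zero {t : ℝ} (ht : Real.sin t ≠ 0) :
    (oscillatingDMS k).rips (Real.sqrt 2) t = pinchedComplex k := by
  refine PreAbstractSimplicialComplex.ext
    (Set.ext fun (σ : Finset (Fin (k + 1) × Bool)) => and_congr_right fun _ => ?_)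
  change (∀ x ∈ σ, ∀ y ∈ σ, oscillatingDist t x y ≤ Real.sqrt 2) ↔ _
  refine ⟨fun h x hx y hy hxy => ?_, fun h x hx y hy => ?_⟩
  · by_contra hne
    rcases hxy with hxy | rfl
    · exact (sqrt_two_lt_oscillatingDist_eq t hxy hne).not_ge (h x hx y hy)
    · exact (sqrt_two_lt_oscillatingDist_zero_true ht hne).not_ge (h _ hx y hy)
  · by_cases hxy : x = y
    · rw [hxy, oscillatingDist_self]
      positivity
    · rw [oscillatingDist_eq, if_neg fun h' => hxy (h x hx y hy (Or.inl h')),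
        oscillatingCoord_sq_of_ne t fun h' => hxy (h x hx y hy (Or.inr h')),
        oscillatingCoord_sq_of_ne t fun h' => hxy (h y hy x hx (Or.inr h')).symm]
      norm_num

theorem crossPolytopeDMS_rips :
    (crossPolytopeDMS k).rips (Real.sqrt 2) = fun _ => crossComplex k := by
  funext t
  -- The constant space is the oscillating one frozen at time 0.
  rw [← oscillatingDMS_rips_of_sin_eq_zero Real.sin_zero]
  refine PreAbstractSimplicialComplex.ext
    (Set.ext fun (σ : Finset (Fin (k + 1) × Bool)) => and_congr_right fun _ => ?_)
  change (∀ x ∈ σ, ∀ y ∈ σ, ‖crossVertex k x - crossVertex k y‖ ≤ Real.sqrt 2) ↔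
    ∀ x ∈ σ, ∀ y ∈ σ, oscillatingDist 0 x y ≤ Real.sqrt 2
  simp only [oscillatingDist_of_sin_eq_zero Real.sin_zero]

/-! ## Tameness, non-isomorphism and the interleaving distance -/

theorem crossPolytopeDMS_tame (k : ℕ) : (crossPolytopeDMS k).Tame :=
  fun x y => TameFunction.const ‖crossVertex k x - crossVertex k y‖

theorem oscillatingDMS_tame (k : ℕ) : (oscillatingDMS k).Tame := by
  have key : ∀ y : Fin (k + 1) × Bool, TameFunction fun t => oscillatingDist t (0, true) y := by
    intro y
    by_cases hne : y = (0, true)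
    · simp only [hne, oscillatingDist_self]
      exact TameFunction.const 0
    -- The distance determines `sin² t`: it is `2 + sin² t` to the antipode, and otherwise strictly
    -- increasing in `1 + sin² t > 0`.
    · refine TameFunction.of_sin_sq ((oscillatingDMS k).continuous_dist _ _) fun t u htu => ?_
      by_cases h : (0 : Fin (k + 1)) = y.1
      · obtain ⟨j, b⟩ := y
        obtain rfl : 0 = j := h
        rcases b with _ | _
        · rw [oscillatingDist_antipodal, oscillatingDist_antipodal,
            oscillatingCoord_zero_true, oscillatingCoord_zero_true] at htu
          linarith
        · exact absurd rfl hne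
      · rw [oscillatingDist_eq, oscillatingDist_eq, if_neg h, if_neg h,
          oscillatingCoord_sq_of_ne t hne, oscillatingCoord_sq_of_ne u hne,
          oscillatingCoord_zero_true, oscillatingCoord_zero_true,
          Real.sqrt_inj (by positivity) (by positivity), add_left_inj,
          sq_eq_sq₀ (by positivity) (by positivity)] at htu
        linarith
  intro (x : Fin (k + 1) × Bool) (y : Fin (k + 1) × Bool)
  change TameFunction fun t => oscillatingDist t x y
  by_cases hx : x = (0, true)
  · rw [hx]
    exact key y
  by_cases hy : y = (0, true)
  · simp only [hy, oscillatingDist_comm _ x]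
    exact key x
  · have h : (fun t => oscillatingDist t x y) =
        fun _ => oscillatingDist 0 x y := by
      funext t
      rw [oscillatingDist_eq, oscillatingDist_eq, oscillatingCoord_of_ne t hx,
        oscillatingCoord_of_ne t hy, oscillatingCoord_of_ne 0 hx, oscillatingCoord_of_ne 0 hy]
    rw [h]
    exact TameFunction.const _

theorem not_isomorphic_oscillatingDMS (k : ℕ) :
    ¬ (crossPolytopeDMS k).Isomorphic (oscillatingDMS k) := by
  rintro ⟨φ, hφ⟩
  have h1 : ∀ t x y, (oscillatingDMS k).dist t x y =
      (crossPolytopeDMS k).dist t (φ.symm x) (φ.symm y) := by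
    intro t x y
    rw [← hφ, Equiv.apply_symm_apply, Equiv.apply_symm_apply]
  -- An isomorphism would make all distances constant in time, but this one is 3 at π/2 and 2 at 0.
  have h2 : oscillatingDist (Real.pi / 2) (0, true) (0, false) =
      oscillatingDist 0 (0, true) (0, false) := (h1 _ _ _).trans (h1 0 _ _).symm
  rw [oscillatingDist_antipodal, oscillatingDist_antipodal, oscillatingCoord_zero_true,
    oscillatingCoord_zero_true, Real.sin_zero, Real.sin_pi_div_two] at h2
  norm_num at h2

theorem DMS.minDist_le (γ : DMS) {I : Set ℝ} {t : ℝ} (ht : t ∈ I) (x y : γ.X) :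
    γ.minDist I x y ≤ γ.dist t x y :=
  csInf_le ⟨0, by rintro _ ⟨s, -, rfl⟩; exact γ.dist_nonneg s x y⟩ ⟨t, ht, rfl⟩

/-- Rounding to the nearest multiple of π; this is the source of the bound π/2. -/
theorem exists_sin_eq_zero_mem_Icc (t : ℝ) :
    ∃ s ∈ Set.Icc (t - Real.pi / 2) (t + Real.pi / 2), Real.sin s = 0 := by
  have hpi := Real.pi_pos
  refine ⟨round (t / Real.pi) * Real.pi, ?_, Real.sin_int_mul_pi _⟩
  have h := abs_le.mp (abs_sub_round (t / Real.pi))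
  have h1 : t / Real.pi * Real.pi = t := div_mul_cancel₀ t hpi.ne'
  constructor <;> nlinarith [h.1, h.2]

/-- The identity tripod works. One inequality holds without time shift, as oscillation only
increases distances; for the other, a nearby zero of the sine makes the two spaces coincide. -/
theorem dynMDist_crossPolytopeDMS_le (k : ℕ) :
    dynMDist (crossPolytopeDMS k) (oscillatingDMS k) ≤ ENNReal.ofReal (Real.pi / 2) := by
  let R : Tripod (crossPolytopeDMS k).X (oscillatingDMS k).X :=
    ⟨Fin (k + 1) × Bool, id, id, Function.surjective_id, Function.surjective_id⟩
  have hpi : 0 ≤ Real.pi / 2 := by positivity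
  refine (iInf_le _ R).trans (iInf₂_le (Real.pi / 2).toNNReal fun t x y => ?_)
  rw [Real.coe_toNNReal _ hpi, NNReal.coe_zero, zero_mul, add_zero, add_zero]
  constructor
  · refine ((crossPolytopeDMS k).minDist_le (t := t)
      (Set.mem_Icc.mpr ⟨by linarith, by linarith⟩) _ _).trans ?_
    refine (oscillatingDist_of_sin_eq_zero Real.sin_zero x y).symm.le.trans ?_
    exact oscillatingDist_zero_le t x y
  · obtain ⟨s, hs, hs0⟩ := exists_sin_eq_zero_mem_Icc t
    refine ((oscillatingDMS k).minDist_le hs _ _).trans ?_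
    exact (oscillatingDist_of_sin_eq_zero hs0 x y).le

end Distances

/-! ## The Rips filtrations and their barcodes -/

section Barcodes

universe u

variable (F : Type u) [Field F] {k : ℕ}

theorem IsZigzagFiltration.const {X : Type} {K : PreAbstractSimplicialComplex X}
    (h : K.faces.Nonempty) : IsZigzagFiltration fun _ => K where
  nonempty _ := h
  tame a b := by simp [critPoints]
  comparable _ := Filter.Eventually.of_forall fun _ => ⟨le_rfl, le_rfl⟩

/-- An indexing set of a constant filtration. -/
noncomputable def IndexingSet.const {X : Type} (K : PreAbstractSimplicialComplex X) :
    IndexingSet fun _ : ℝ => K where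
  c i := i
  s i := i + 1 / 2
  strictMono_c := Int.cast_strictMono
  tendsto_atTop := tendsto_intCast_atTop_atTop
  tendsto_atBot := tendsto_intCast_atBot_iff.mpr Filter.tendsto_id
  crit_subset t ht := absurd (Filter.Eventually.of_forall fun _ => rfl) ht
  s_mem i := ⟨by linarith, by push_cast; linarith⟩

theorem crossComplex_nonempty (k : ℕ) : (crossComplex k).faces.Nonempty :=
  ⟨{(0, true)}, by simp, by simp⟩

theorem pinchedComplex_nonempty (k : ℕ) : (pinchedComplex k).faces.Nonempty :=
  ⟨{(0, true)}, by simp, by simp⟩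

theorem exists_isHomologyBarcode_const (hk : 1 ≤ k) :
    ∃ A, IsHomologyBarcode F k (fun _ => crossComplex k) A := by
  obtain ⟨φ⟩ := nonempty_homology_crossComplex_equiv F hk
  refine ⟨⟨Unit, fun _ => Set.univ, fun _ => Set.univ_nonempty, fun _ => Set.ordConnected_univ⟩,
    IsZigzagFiltration.const (crossComplex_nonempty k), IndexingSet.const _,
    fun _ => PosetInterval.zzUniv, ?_, fun _ => ?_⟩
  · refine nonempty_iso_intervalSum_zzUniv _ (fun _ => φ) fun _ x => ?_
    exact congrArg φ (LinearMap.congr_fun (simplicialHomologyMap_id F le_rfl k) x)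
  · exact (IndexingSet.realInterval_eq_univ _ rfl).symm

theorem exists_eq_univ_of_isHomologyBarcode_const (hk : 1 ≤ k) {A : Barcode}
    (hA : IsHomologyBarcode F k (fun _ => crossComplex k) A) : ∃ a, A.I a = Set.univ := by
  obtain ⟨hf, K, J, ⟨e⟩, hI⟩ := hA
  obtain ⟨φ⟩ := nonempty_homology_crossComplex_equiv F hk
  obtain ⟨j, hj⟩ := exists_carrier_eq_univ e φ.toEquiv.nontrivial fun {p q} f => by
    refine (CategoryTheory.ConcreteCategory.isIso_iff_bijective _).mpr ?_
    have h : ∀ x, (((homologyModule F k (K.diagram hf)).map f).hom x) = x :=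
      LinearMap.congr_fun (simplicialHomologyMap_id F (K := crossComplex k) le_rfl k)
    exact ⟨fun x y hxy => (h x).symm.trans (hxy.trans (h y)), fun x => ⟨x, h x⟩⟩
  exact ⟨j, (hI j).trans (K.realInterval_eq_univ hj)⟩

/-! ### The pinched filtration and its barcode -/

open Classical in
/-- The Rips filtration of `oscillatingDMS`. -/
noncomputable def pinchedFiltration (k : ℕ) (t : ℝ) :
    PreAbstractSimplicialComplex (Fin (k + 1) × Bool) :=
  if Real.sin t = 0 then crossComplex k else pinchedComplex k

theorem oscillatingDMS_rips :
    (oscillatingDMS k).rips (Real.sqrt 2) = pinchedFiltration k := by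
  funext t
  by_cases h : Real.sin t = 0
  · exact (oscillatingDMS_rips_of_sin_eq_zero h).trans (if_pos h).symm
  · exact (oscillatingDMS_rips_of_sin_ne_zero h).trans (if_neg h).symm

theorem pinchedFiltration_le (t : ℝ) : pinchedFiltration k t ≤ crossComplex k := by
  rw [pinchedFiltration]
  split_ifs
  · exact le_rfl
  · exact pinchedComplex_le k

theorem eventually_pinchedFiltration_eq {t : ℝ} (ht : Real.sin t ≠ 0) :
    ∀ᶠ u in nhds t, pinchedFiltration k u = pinchedFiltration k t := by
  filter_upwards [Real.continuous_sin.continuousAt.eventually_ne ht] with u hu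
  rw [pinchedFiltration, pinchedFiltration, if_neg hu, if_neg ht]

/-- If the sine vanished near `t`, so would its derivative, against `sin² + cos² = 1`. -/
theorem frequently_sin_ne_zero (t : ℝ) : ∃ᶠ u in nhds t, Real.sin u ≠ 0 := by
  intro h
  have h0 : Real.sin =ᶠ[nhds t] fun _ => 0 := h.mono fun _ hu => not_not.mp hu
  have hsin := h0.eq_of_nhds
  have hcos := h0.deriv_eq
  rw [Real.deriv_sin, deriv_const] at hcos
  have := Real.sin_sq_add_cos_sq t
  rw [hsin, hcos] at this
  norm_num at this

theorem critPoints_pinchedFiltration (hk : 1 ≤ k) :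
    critPoints (pinchedFiltration k) = {t | Real.sin t = 0} := by
  ext t
  refine ⟨fun h => ?_, fun ht h => ?_⟩
  · by_contra ht
    exact h (eventually_pinchedFiltration_eq ht)
  · obtain ⟨u, hu, hut⟩ := ((frequently_sin_ne_zero t).and_eventually h).exists
    rw [pinchedFiltration, pinchedFiltration, if_neg hu,
      if_pos (show Real.sin t = 0 from ht)] at hut
    exact pinchedComplex_ne hk hut

theorem isZigzagFiltration_pinchedFiltration (hk : 1 ≤ k) :
    IsZigzagFiltration (pinchedFiltration k) where
  nonempty t := by
    rw [pinchedFiltration]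
    split_ifs
    · exact crossComplex_nonempty k
    · exact pinchedComplex_nonempty k
  tame a b := by
    rw [critPoints_pinchedFiltration hk]
    refine (finite_sin_sq_eq_inter 0 (Metric.isBounded_Icc a b)).subset ?_
    rintro t ⟨ht, hI⟩
    have ht : Real.sin t = 0 := ht
    exact ⟨show Real.sin t ^ 2 = Real.sin 0 ^ 2 by rw [ht, Real.sin_zero], hI⟩
  comparable t := by
    -- At a zero the complex is the largest one; elsewhere it is locally constant.
    by_cases ht : Real.sin t = 0
    · refine Filter.Eventually.of_forall fun ε => ?_
      have h : pinchedFiltration k t = crossComplex k := if_pos ht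
      rw [h]
      exact ⟨pinchedFiltration_le _, pinchedFiltration_le _⟩
    · have h := eventually_pinchedFiltration_eq (k := k) ht
      have h1 : Filter.Tendsto (fun ε : ℝ => t - ε) (nhdsWithin 0 (Set.Ioi 0)) (nhds t) := by
        refine Filter.Tendsto.mono_left ?_ nhdsWithin_le_nhds
        exact Continuous.tendsto' (by fun_prop) _ _ (sub_zero t)
      have h2 : Filter.Tendsto (fun ε : ℝ => t + ε) (nhdsWithin 0 (Set.Ioi 0)) (nhds t) := by
        refine Filter.Tendsto.mono_left ?_ nhdsWithin_le_nhds
        exact Continuous.tendsto' (by fun_prop) _ _ (add_zero t)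
      filter_upwards [h1.eventually h, h2.eventually h] with ε he he'
      exact ⟨he.le, he'.le⟩

/-- The zeros of the sine as an indexing set of `pinchedFiltration`. -/
noncomputable def pinchedIndexingSet (hk : 1 ≤ k) : IndexingSet (pinchedFiltration k) where
  c i := i * Real.pi
  s i := i * Real.pi + Real.pi / 2
  strictMono_c _ _ h := mul_lt_mul_of_pos_right (Int.cast_lt.mpr h) Real.pi_pos
  tendsto_atTop := tendsto_intCast_atTop_atTop.atTop_mul_const Real.pi_pos
  tendsto_atBot := (tendsto_intCast_atBot_iff.mpr Filter.tendsto_id).atBot_mul_const Real.pi_pos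
  crit_subset t ht := by
    rw [critPoints_pinchedFiltration hk] at ht
    exact Real.sin_eq_zero_iff.mp ht
  s_mem i := by
    have := Real.pi_pos
    exact ⟨by linarith, by push_cast; linarith⟩

/-- Every zero of the sine is critical, hence some `c j`, while `s i` lies strictly between
consecutive ones. -/
theorem subsingleton_homology_pinchedFiltration (hk : 1 ≤ k)
    (K : IndexingSet (pinchedFiltration k)) (i : ℤ) :
    Subsingleton (SimplicialHomology F (pinchedFiltration k (K.s i)) k) := by
  have hs : Real.sin (K.s i) ≠ 0 := by
    intro h
    obtain ⟨j, hj⟩ := K.crit_subset ((critPoints_pinchedFiltration hk).ge h)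
    have h1 := K.strictMono_c.lt_iff_lt.mp ((K.s_mem i).1.trans_eq hj.symm)
    have h2 := K.strictMono_c.lt_iff_lt.mp (hj.trans_lt (K.s_mem i).2)
    omega
  rw [pinchedFiltration, if_neg hs]
  exact subsingleton_homology_pinchedComplex F hk

theorem exists_isHomologyBarcode_pinchedFiltration (hk : 1 ≤ k) :
    ∃ B, IsHomologyBarcode F k (pinchedFiltration k) B := by
  refine ⟨⟨ℤ, fun i => {i * Real.pi}, fun _ => Set.singleton_nonempty _,
    fun _ => Set.ordConnected_singleton⟩,
    isZigzagFiltration_pinchedFiltration hk, pinchedIndexingSet hk,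
    fun i => PosetInterval.point (ZZ.c i), ?_, fun i => ?_⟩
  · refine nonempty_iso_intervalSum_points _
      (fun i => subsingleton_homology_pinchedFiltration F hk (pinchedIndexingSet hk) i) fun i => ?_
    have h : pinchedFiltration k (i * Real.pi) = crossComplex k := if_pos (Real.sin_int_mul_pi i)
    change Nonempty (SimplicialHomology F (pinchedFiltration k (i * Real.pi)) k ≃ₗ[F] F)
    rw [h]
    exact nonempty_homology_crossComplex_equiv F hk
  · exact ((pinchedIndexingSet hk).realInterval_point i).symm

/-- The homology vanishes at each `s i`, so no interval of any decomposition contains one, and no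
bar contains an open gap. -/
theorem subsingleton_of_isHomologyBarcode_pinchedFiltration (hk : 1 ≤ k) {B : Barcode}
    (hB : IsHomologyBarcode F k (pinchedFiltration k) B) (b : B.ι) : (B.I b).Subsingleton := by
  obtain ⟨hf, K, J, ⟨e⟩, hI⟩ := hB
  rw [hI]
  refine K.realInterval_subsingleton fun i => ?_
  have h : Subsingleton ((homologyModule F k (K.diagram hf)).obj (ZZ.s i)) :=
    subsingleton_homology_pinchedFiltration F hk K i
  exact notMem_of_subsingleton e h b

end Barcodes

theorem mainTheorem11 (k : ℕ) (hk : 1 ≤ k) :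
    ∃ (γX γY : DMS) (δ : ℝ),
      γX = crossPolytopeDMS k ∧ γY = oscillatingDMS k ∧ δ = Real.sqrt 2 ∧
      γX.Tame ∧ γY.Tame ∧ ¬ γX.Isomorphic γY ∧
      dynMDist γX γY < ⊤ ∧ dynMDist γX γY ≤ ENNReal.ofReal (Real.pi / 2) ∧
      ∀ (F : Type*) [Field F],
        (∃ A, IsHomologyBarcode F k (γX.rips δ) A) ∧
        (∃ B, IsHomologyBarcode F k (γY.rips δ) B) ∧
        ∀ A B, IsHomologyBarcode F k (γX.rips δ) A → IsHomologyBarcode F k (γY.rips δ) B →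
          A.bottleneckDist B = ⊤ := by
  refine ⟨_, _, _, rfl, rfl, rfl, crossPolytopeDMS_tame k, oscillatingDMS_tame k,
    not_isomorphic_oscillatingDMS k,
    (dynMDist_crossPolytopeDMS_le k).trans_lt ENNReal.ofReal_lt_top,
    dynMDist_crossPolytopeDMS_le k, fun F _ => ?_⟩
  rw [crossPolytopeDMS_rips, oscillatingDMS_rips]
  refine ⟨exists_isHomologyBarcode_const F hk, exists_isHomologyBarcode_pinchedFiltration F hk,
    fun A B hA hB => ?_⟩
  obtain ⟨a, ha⟩ := exists_eq_univ_of_isHomologyBarcode_const F hk hA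
  exact Barcode.bottleneckDist_eq_top ha
    fun b => subsingleton_of_isHomologyBarcode_pinchedFiltration F hk hB b
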